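/- \textbf{Setting.} Fix $d\in\mathbb{N}$ and $r>0$, let $\mathbb{B}^d_r=\{x\in\mathbb{R}^d:\|x\|_2\le r\}$, and let $\lambda$ be Lebesgue measure on $[0,1]$. A \emph{graphon-signal} is a pair $(W,f)$ of a symmetric Borel measurable $W:[0,1]^2\to[0,1]$ and a Borel measurable $f:[0,1]\to\mathbb{B}^d_r$; $\mathcal{WL}^d_r$ denotes the set of all graphon-signals. A \emph{graph-signal} $(G,\mathbf{f})$ is a finite simple undirected graph $G$ with node set $\{1,\dots,N\}$, $N\ge 1$, and adjacency matrix $(a_{ij})\in\{0,1\}^{N\times N}$, together with $\mathbf{f}=(\mathbf{f}_1,\dots,\mathbf{f}_N)$, $\mathbf{f}_i\in\mathbb{B}^d_r$. It induces the graphon-signal $$W_G(x,y)=\sum_{i,j=1}^N a_{ij}\mathbf{1}_{I_i}(x)\mathbf{1}_{I_j}(y),\qquad f_{\mathbf{f}}(z)=\sum_{i=1}^N \mathbf{f}_i\mathbf{1}_{I_i}(z),\qquad I_i=[\tfrac{i-1}{N},\tfrac{i}{N}).$$ For a topological space $X$ with its Borel $\sigma$-algebra let $\mathscr{M}_{\le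 1}(X)$ be the set of nonnegative Borel measures on $X$ of total mass at most $1$, with the weak$^*$ topology (generated by $\mu\mapsto\int g\,d\mu$, $g$ bounded continuous). For a distance $D$ on $X$ and $\mu,\nu\in\mathscr{M}_{\le 1}(X)$ with $\|\mu\|:=\mu(X)\le\|\nu\|:=\nu(X)$ put $$\mathbf{OT}_D(\mu,\nu)=\mathbf{OT}_D(\nu,\mu)=\inf_\gamma\int_{X\times X}D\,d\gamma+\big|\|\mu\|-\|\nu\|\big|,$$ the infimum being over all nonnegative measures $\gamma$ on $X\times X$ whose first marginal is $\mu$ and whose second marginal is $\le\nu$. Define inductively $\mathcal{M}^0=\mathbb{B}^d_r$, $\mathcal{H}^L=\prod_{j\le L}\mathcal{M}^j$ (product topology), $\mathcal{M}^{L+1}=\mathscr{M}_{\le1}(\mathcal{H}^L)$, and the distance on $\mathcal{H}^L$ $$d^L_{\rm IDM}(\mu,\nu)=\|\mu_0-\nu_0\|_2+\sum_{j=1}^L\mathbf{OT}_{d^{j-1}_{\rm IDM}}(\mu_j,\nu_j).$$ For a graphon-signal $(W,f)$ define $\gamma_{(W,f),L}:[0,1]\to\mathcal{H}^L$ by $\gamma_{(W,f),0}=f$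 and $\gamma_{(W,f),L+1}(x)=\big(\gamma_{(W,f),L}(x),\,A\mapsto\int_{\gamma_{(W,f),L}^{-1}(A)}W(x,y)\,d\lambda(y)\big)$, let $\Gamma_{(W,f),L}=(\gamma_{(W,f),L})_*\lambda$, and set $$\delta^L_{\rm DIDM}\big((W,f),(V,g)\big)=\mathbf{OT}_{d^L_{\rm IDM}}\big(\Gamma_{(W,f),L},\Gamma_{(V,g),L}\big).$$ \textbf{Theorem.} Let $L\in\mathbb{N}=\{0,1,2,\dots\}$. Graph-signals, identified with their induced graphon-signals, are dense in $\mathcal{WL}^d_r$ with respect to $\delta^L_{\rm DIDM}$: for every $(W,f)\in\mathcal{WL}^d_r$ and every $\varepsilon>0$ there is a graph-signal $(G,\mathbf{f})$ with $\delta^L_{\rm DIDM}\big((W,f),(W_G,f_{\mathbf{f}})\big)<\varepsilon$. -/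

import Mathlib

open MeasureTheory
open scoped ENNReal NNReal unitInterval

noncomputable section

/-! ### Sub-probability measures and unbalanced optimal transport -/

/-- The nonnegative measures on `X` of total mass at most one, with the weak-* topology (the
subspace topology of `FiniteMeasure X`). -/
abbrev SubProb (X : Type) [MeasurableSpace X] : Type :=
  {μ : FiniteMeasure X // μ.mass ≤ 1}

/-- `γ` is a coupling of `μ` and `ν`: the marginal of `γ` on the side of the lighter measure is that
measure, and the other marginal is dominated by the heavier one. (If the masses agree, both
requirements say that the marginals are `μ` and `ν`.) -/
def IsCoupling {X : Type} [MeasurableSpace X] (γ : Measure (X × X)) (μ ν : FiniteMeasure X) :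
    Prop :=
  (μ.mass ≤ ν.mass →
    γ.map Prod.fst = (μ : Measure X) ∧ γ.map Prod.snd ≤ (ν : Measure X)) ∧
  (ν.mass ≤ μ.mass →
    γ.map Prod.fst ≤ (μ : Measure X) ∧ γ.map Prod.snd = (ν : Measure X))

/-- Unbalanced optimal transport distance for the ground distance `dist`:
infimum over all couplings of the transport cost, plus the difference of the total masses. -/
def unbalancedOT {X : Type} [MeasurableSpace X] (dist : X → X → ℝ≥0∞) (μ ν : FiniteMeasure X) :
    ℝ≥0∞ :=
  (⨅ (γ : Measure (X × X)) (_ : IsCoupling γ μ ν), ∫⁻ p, dist p.1 p.2 ∂γ) +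
    ENNReal.ofReal |(μ.mass : ℝ) - (ν.mass : ℝ)|

/-! ### The spaces of iterated degree measures -/

/-- A topological space together with its Borel sigma-algebra. -/
structure BorelTop where
  carrier : Type
  [top : TopologicalSpace carrier]
  [meas : MeasurableSpace carrier]
  [borel : BorelSpace carrier]

attribute [instance] BorelTop.top BorelTop.meas BorelTop.borel

/-- The space of node attributes: the closed ball of radius `r` in Euclidean `d`-space. -/
abbrev AttrBall (d : ℕ) (r : ℝ) : Type :=
  Metric.closedBall (0 : EuclideanSpace ℝ (Fin d)) r

/-- From `X` to `X × SubProb X`, with the product topology and its Borel sigma-algebra. -/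
def BorelTop.next (X : BorelTop) : BorelTop :=
  letI : MeasurableSpace (X.carrier × SubProb X.carrier) :=
    _root_.borel (X.carrier × SubProb X.carrier)
  haveI : BorelSpace (X.carrier × SubProb X.carrier) := ⟨rfl⟩
  { carrier := X.carrier × SubProb X.carrier }

/-- The tower of spaces of iterated degree measures. -/
def idmTower (d : ℕ) (r : ℝ) : ℕ → BorelTop
  | 0 => { carrier := AttrBall d r }
  | L + 1 => (idmTower d r L).next

/-- `IDM d r L` is the space of iterated degree measures of order `L`: order `0` is the ball of
attributes `M⁰`, and order `L + 1` is (order `L`) `×` `M^(L+1)`, where `M^(L+1)` is the space of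
measures of mass at most one on order `L`. So order `L` is the product `M⁰ × M¹ × ⋯ × M^L`. -/
abbrev IDM (d : ℕ) (r : ℝ) (L : ℕ) : Type := (idmTower d r L).carrier

/-- The distance on iterated degree measures: the Euclidean distance of the `0`-th entries plus the
sum over `1 ≤ j ≤ L` of the unbalanced optimal transport distances of the `j`-th entries. -/
def idmDist (d : ℕ) (r : ℝ) : (L : ℕ) → IDM d r L → IDM d r L → ℝ≥0∞
  | 0 => fun (x y : AttrBall d r) => edist (x : EuclideanSpace ℝ (Fin d)) y
  | L + 1 => fun (x y : IDM d r L × SubProb (IDM d r L)) =>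
      idmDist d r L x.1 y.1 + unbalancedOT (idmDist d r L) x.2.1 y.2.1

/-! ### Graphon-signals and the DIDM mover's distance -/

/-- A graphon-signal: a symmetric measurable `W : [0,1]² → [0,1]` and a measurable signal
with values in the ball of attributes. -/
structure GraphonSignal (d : ℕ) (r : ℝ) where
  W : I → I → ℝ
  measurable_W : Measurable (Function.uncurry W)
  symm_W : ∀ x y, W x y = W y x
  nonneg_W : ∀ x y, 0 ≤ W x y
  le_one_W : ∀ x y, W x y ≤ 1
  f : I → AttrBall d r
  measurable_f : Measurable f

theorem map_withDensity_univ_le {X : Type} [MeasurableSpace X] (w : I → ℝ) (hw : ∀ y, w y ≤ 1)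
    (g : I → X) :
    ((volume : Measure I).withDensity (fun y => ENNReal.ofReal (w y))).map g Set.univ ≤ 1 := by
  by_cases hg : AEMeasurable g ((volume : Measure I).withDensity (fun y => ENNReal.ofReal (w y)))
  · rw [Measure.map_apply_of_aemeasurable hg MeasurableSet.univ, Set.preimage_univ,
      withDensity_apply _ MeasurableSet.univ, Measure.restrict_univ]
    calc ∫⁻ y, ENNReal.ofReal (w y) ∂(volume : Measure I)
        ≤ ∫⁻ _, 1 ∂(volume : Measure I) :=
          lintegral_mono fun y => ENNReal.ofReal_le_one.2 (hw y)
      _ = 1 := by simp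
  · simp [Measure.map_of_not_aemeasurable hg]

namespace GraphonSignal

variable {d : ℕ} {r : ℝ}

/-- One aggregation step at the node `x`: the measure `A ↦ ∫_{g⁻¹(A)} W(x, y) dy`, that is, the
push-forward by `g` of the measure with density `W(x, ·)`. -/
def aggregate (Q : GraphonSignal d r) {X : Type} [MeasurableSpace X] (g : I → X) (x : I) :
    SubProb X :=
  ⟨⟨((volume : Measure I).withDensity (fun y => ENNReal.ofReal (Q.W x y))).map g,
    ⟨(map_withDensity_univ_le (Q.W x) (Q.le_one_W x) g).trans_lt ENNReal.one_lt_top⟩⟩,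
    ENNReal.toNNReal_mono ENNReal.one_ne_top
      (map_withDensity_univ_le (Q.W x) (Q.le_one_W x) g)⟩

/-- The computation iterated degree measure of order `L` of every node. -/
def compIDM (Q : GraphonSignal d r) : (L : ℕ) → I → IDM d r L
  | 0 => Q.f
  | L + 1 => fun x =>
      ((Q.compIDM L x, Q.aggregate (Q.compIDM L) x) : IDM d r L × SubProb (IDM d r L))

/-- The distribution of computation iterated degree measures of order `L`: the push-forward of
Lebesgue measure on `[0,1]` by the computation iterated degree measure. -/
def compDIDM (Q : GraphonSignal d r) (L : ℕ) : FiniteMeasure (IDM d r L) :=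
  ⟨(volume : Measure I).map (Q.compIDM L), inferInstance⟩

/-- The DIDM mover's distance of order `L`. -/
def didmDist (L : ℕ) (Q Q' : GraphonSignal d r) : ℝ≥0∞ :=
  unbalancedOT (idmDist d r L) (Q.compDIDM L) (Q'.compDIDM L)

end GraphonSignal

/-! ### Graph-signals and the graphon-signals they induce -/

/-- A graph-signal: a finite graph on `N ≥ 1` nodes with a node attribute in the ball for each
node. -/
structure GraphSignal (d : ℕ) (r : ℝ) where
  N : ℕ
  pos : 0 < N
  graph : SimpleGraph (Fin N)
  signal : Fin N → AttrBall d r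

/-- The `i`-th (counted from zero) interval `[i/N, (i+1)/N)` of the equipartition of `[0,1]`. -/
def equiInterval (N : ℕ) (i : Fin N) : Set I :=
  {x | (i : ℝ) / N ≤ (x : ℝ) ∧ (x : ℝ) < ((i : ℝ) + 1) / N}

theorem measurableSet_equiInterval (N : ℕ) (i : Fin N) : MeasurableSet (equiInterval N i) :=
  (measurableSet_le measurable_const measurable_subtype_coe).inter
    (measurableSet_lt measurable_subtype_coe measurable_const)

theorem equiInterval_unique {N : ℕ} {i j : Fin N} {x : I} (hi : x ∈ equiInterval N i)
    (hj : x ∈ equiInterval N j) : i = j := by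
  have hN : (0 : ℝ) < N := by exact_mod_cast i.pos
  obtain ⟨h1, h2⟩ := hi
  obtain ⟨h3, h4⟩ := hj
  have a : (i : ℝ) < (j : ℝ) + 1 := (div_lt_div_iff_of_pos_right hN).1 (h1.trans_lt h4)
  have b : (j : ℝ) < (i : ℝ) + 1 := (div_lt_div_iff_of_pos_right hN).1 (h3.trans_lt h2)
  have a' : (i : ℕ) < j + 1 := by exact_mod_cast a
  have b' : (j : ℕ) < i + 1 := by exact_mod_cast b
  exact Fin.ext (by omega)

/-- `∑ᵢ cᵢ 1_{Iᵢ}(x)` for the equipartition into `N` intervals. -/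
def stepFun {E : Type} [AddCommMonoid E] (N : ℕ) (c : Fin N → E) (x : I) : E :=
  ∑ i, (equiInterval N i).indicator (fun _ => c i) x

theorem stepFun_cases {E : Type} [AddCommMonoid E] (N : ℕ) (c : Fin N → E) (x : I) :
    stepFun N c x = 0 ∨ ∃ i, stepFun N c x = c i := by
  by_cases h : ∃ i, x ∈ equiInterval N i
  · obtain ⟨i, hi⟩ := h
    refine Or.inr ⟨i, ?_⟩
    unfold stepFun
    rw [Finset.sum_eq_single i, Set.indicator_of_mem hi]
    · intro j _ hji
      exact Set.indicator_of_notMem (fun hj => hji (equiInterval_unique hj hi)) _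
    · simp
  · push Not at h
    exact Or.inl (Finset.sum_eq_zero fun i _ => Set.indicator_of_notMem (h i) _)

namespace GraphSignal

variable {d : ℕ} {r : ℝ}

open scoped Classical in
/-- The adjacency matrix entry. -/
def adj (G : GraphSignal d r) (i j : Fin G.N) : ℝ := if G.graph.Adj i j then 1 else 0

/-- The induced step graphon `∑ᵢⱼ aᵢⱼ 1_{Iᵢ}(x) 1_{Iⱼ}(y)`. -/
def stepGraphon (G : GraphSignal d r) (x y : I) : ℝ :=
  ∑ i, ∑ j, G.adj i j * (equiInterval G.N i).indicator (fun _ => 1) x *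
    (equiInterval G.N j).indicator (fun _ => 1) y

theorem stepGraphon_eq (G : GraphSignal d r) (x y : I) :
    G.stepGraphon x y = stepFun G.N (fun i => stepFun G.N (fun j => G.adj i j) y) x := by
  unfold stepGraphon stepFun
  refine Finset.sum_congr rfl fun i _ => ?_
  by_cases hx : x ∈ equiInterval G.N i
  · rw [Set.indicator_of_mem hx, Set.indicator_of_mem hx]
    refine Finset.sum_congr rfl fun j _ => ?_
    by_cases hy : y ∈ equiInterval G.N j <;> simp [hy]
  · simp [hx]

theorem stepGraphon_mem (G : GraphSignal d r) (x y : I) :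
    G.stepGraphon x y = 0 ∨ G.stepGraphon x y = 1 := by
  rw [stepGraphon_eq]
  rcases stepFun_cases G.N (fun i => stepFun G.N (fun j => G.adj i j) y) x with h | ⟨i, h⟩
  · exact Or.inl h
  · rw [h]
    rcases stepFun_cases G.N (fun j => G.adj i j) y with h' | ⟨j, h'⟩
    · exact Or.inl h'
    · rw [h']
      unfold adj
      split_ifs
      · exact Or.inr rfl
      · exact Or.inl rfl

/-- The graphon-signal induced by a graph-signal. -/
def toGraphonSignal (G : GraphSignal d r) : GraphonSignal d r where
  W := G.stepGraphon
  measurable_W := by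
    have h : ∀ i : Fin G.N,
        Measurable ((equiInterval G.N i).indicator (fun _ => (1 : ℝ))) := fun i =>
      measurable_const.indicator (measurableSet_equiInterval _ i)
    change Measurable fun p : I × I => G.stepGraphon p.1 p.2
    unfold stepGraphon
    refine Finset.measurable_fun_sum _ fun i _ => Finset.measurable_fun_sum _ fun j _ => ?_
    exact (measurable_const.mul ((h i).comp measurable_fst)).mul ((h j).comp measurable_snd)
  symm_W := by
    intro x y
    unfold stepGraphon
    rw [Finset.sum_comm]
    refine Finset.sum_congr rfl fun i _ => Finset.sum_congr rfl fun j _ => ?_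
    have : G.adj j i = G.adj i j := by
      unfold adj
      by_cases h : G.graph.Adj i j
      · rw [if_pos h, if_pos h.symm]
      · rw [if_neg h, if_neg fun h' => h h'.symm]
    rw [this]
    ring
  nonneg_W := by
    intro x y
    rcases G.stepGraphon_mem x y with h | h <;> rw [h]
    exact zero_le_one
  le_one_W := by
    intro x y
    rcases G.stepGraphon_mem x y with h | h <;> rw [h]
    exact zero_le_one
  f := fun x => ⟨stepFun G.N (fun i => (G.signal i : EuclideanSpace ℝ (Fin d))) x, by
    rcases stepFun_cases G.N (fun i => (G.signal i : EuclideanSpace ℝ (Fin d))) x with h | ⟨i, h⟩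
    · rw [h]
      have := (G.signal ⟨0, G.pos⟩).2
      exact Metric.mem_closedBall_self (Metric.nonempty_closedBall.1 ⟨_, this⟩)
    · rw [h]
      exact (G.signal i).2⟩
  measurable_f := by
    refine Measurable.subtype_mk ?_
    exact Finset.measurable_fun_sum _ fun i _ =>
      measurable_const.indicator (measurableSet_equiInterval _ i)

end GraphSignal

end

/-! An iterated degree measure sees a graphon only through the weight that a node sends to sets of
nodes that look alike, not through the arrangement of edges inside a block. A density `p` between
two blocks can therefore be imitated by a 0/1 pattern in which every node has about the proportion
`p` of neighbours in the other block. No randomness is needed: with the nodes of a block indexed by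
residues mod `m`, joining `s` to `t` when `s + t mod m < a` is symmetric and gives every node
exactly `a` neighbours, up to a removed loop.

Stability (`exists_idmDist_compIDM_le`): if, on a common finite partition, the signals and the
degrees into blocks of two graphon-signals agree up to errors small in L¹, then nodes of the same
block have close iterated degree measures, with an error whose integral is controlled by a constant
depending only on `d`, `r`, `L`. This is an induction on `L` that transports mass block by block
(`unbalancedOT_map_le_of_blocks`).

Approximation (`exists_blockClose`): `W` and `f` are L¹-close to step functions on a fine
equipartition, and a block graph realises the step densities up to `2 / m`.

Measurability (`measurable_compIDM`): the node maps must be Borel for the weak topology, while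
Fubini only gives measurability of evaluations on sets. Second countability of the weak topology
bridges the two. -/

noncomputable section

/-! ### The weak topology on finite measures is second countable -/

namespace FiniteMeasureTopology

open Filter Topology

variable {X : Type*} [MeasurableSpace X] [TopologicalSpace X] [OpensMeasurableSpace X]

instance regularSpace_finiteMeasure : RegularSpace (FiniteMeasure X) := by
  have h1 : IsInducing (FiniteMeasure.toWeakDualBCNN (Ω := X)) := ⟨rfl⟩
  have h2 : IsInducing fun (x : WeakDual ℝ≥0 (BoundedContinuousFunction X ℝ≥0)) y => x y := ⟨rfl⟩
  exact (h2.comp h1).regularSpace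

theorem lintegral_add_lintegral_sub (f : BoundedContinuousFunction X ℝ≥0) {M : ℝ≥0}
    (hM : ∀ x, f x ≤ M) (μ : Measure X) :
    ∫⁻ x, f x ∂μ + ∫⁻ x, ENNReal.ofReal ((M : ℝ) - f x) ∂μ = M * μ Set.univ := by
  have hf : Measurable fun x => (f x : ℝ≥0∞) := f.continuous.measurable.coe_nnreal_ennreal
  rw [← lintegral_add_left hf, ← lintegral_const]
  refine lintegral_congr fun x => ?_
  rw [← ENNReal.ofReal_coe_nnreal, ← ENNReal.ofReal_coe_nnreal, ← ENNReal.ofReal_add (f x).coe_nonneg]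
  · congr 1; ring
  · have := hM x
    exact sub_nonneg.2 (by exact_mod_cast this)

/-- Convergence of the masses together with the lower bound of the portmanteau theorem on open sets
implies weak convergence of finite measures. -/
theorem tendsto_of_forall_isOpen_le_liminf {μ : FiniteMeasure X} {μs : ℕ → FiniteMeasure X}
    (hmass : Tendsto (fun i => (μs i : Measure X) Set.univ) atTop (𝓝 ((μ : Measure X) Set.univ)))
    (hopen : ∀ G, IsOpen G → (μ : Measure X) G ≤ atTop.liminf fun i => (μs i : Measure X) G) :
    Tendsto μs atTop (𝓝 μ) := by
  rw [FiniteMeasure.tendsto_iff_forall_lintegral_tendsto]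
  intro f
  obtain ⟨M, hM⟩ : ∃ M : ℝ≥0, ∀ x, f x ≤ M :=
    ⟨nndist f 0, fun x => by simpa using BoundedContinuousFunction.nndist_coe_le_nndist (f := f) (g := 0) x⟩
  have key := fun (g : X → ℝ) (hg : Continuous g) (h0 : 0 ≤ g) =>
    lintegral_le_liminf_lintegral_of_forall_isOpen_measure_le_liminf_measure hg h0 hopen
  -- The bound for `f` controls its integrals from below; the bound for `M - f`, combined with
  -- convergence of the masses, controls them from above.
  have k1 := key (fun x => f x) (by fun_prop) (fun x => (f x).coe_nonneg)
  simp only [ENNReal.ofReal_coe_nnreal] at k1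
  have k2 := key (fun x => (M : ℝ) - f x) (by fun_prop)
    (fun x => sub_nonneg.2 (by exact_mod_cast hM x))
  have hMmass : Tendsto (fun i => (M : ℝ≥0∞) * (μs i : Measure X) Set.univ) atTop
      (𝓝 (M * (μ : Measure X) Set.univ)) := ENNReal.Tendsto.const_mul hmass (Or.inr (by simp))
  have hfin : ∀ ν : FiniteMeasure X, ∫⁻ x, ENNReal.ofReal ((M : ℝ) - f x) ∂(ν : Measure X) ≠ ∞ := by
    intro ν
    refine ne_top_of_le_ne_top ?_ (le_add_self.trans (lintegral_add_lintegral_sub f hM ν).le)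
    exact ENNReal.mul_ne_top (by simp) (by simp)
  refine tendsto_order.2 ⟨fun a ha => eventually_lt_of_lt_liminf (ha.trans_le k1), fun a ha => ?_⟩
  have hlt : (M : ℝ≥0∞) * (μ : Measure X) Set.univ <
      a + ∫⁻ x, ENNReal.ofReal ((M : ℝ) - f x) ∂(μ : Measure X) := by
    rw [← lintegral_add_lintegral_sub f hM]
    exact ENNReal.add_lt_add_right (hfin μ) ha
  by_cases h0 : ∫⁻ x, ENNReal.ofReal ((M : ℝ) - f x) ∂(μ : Measure X) = 0
  · rw [h0, add_zero] at hlt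
    filter_upwards [hMmass.eventually_lt_const hlt] with i hi
    exact (le_self_add.trans (lintegral_add_lintegral_sub f hM _).le).trans_lt hi
  · obtain ⟨a', ha', c, hc, hac⟩ := ENNReal.exists_lt_add_of_lt_add hlt ha.ne_bot h0
    filter_upwards [hMmass.eventually_lt_const hac, eventually_lt_of_lt_liminf (hc.trans_le k2)]
      with i h1 h2
    rw [← lintegral_add_lintegral_sub f hM] at h1
    by_contra h
    rw [not_lt] at h
    exact absurd h1 (not_lt.2 (add_le_add (ha'.le.trans h) h2.le))

/-- Lower semicontinuity on open sets: the total mass is continuous, and the mass of the closed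
complement is upper semicontinuous by the portmanteau theorem. -/
theorem isOpen_setOf_lt_measure [HasOuterApproxClosed X] {G : Set X} (hG : IsOpen G) (q : ℝ≥0∞) :
    IsOpen {μ : FiniteMeasure X | q < (μ : Measure X) G} := by
  refine isOpen_iff_mem_nhds.2 fun μ hμ => ?_
  have hadd : ∀ ν : FiniteMeasure X,
      (ν : Measure X) G + (ν : Measure X) Gᶜ = (ν : Measure X) Set.univ :=
    fun ν => measure_add_measure_compl hG.measurableSet
  have hmass : Tendsto (fun ν : FiniteMeasure X => (ν : Measure X) Set.univ) (𝓝 μ)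
      (𝓝 ((μ : Measure X) Set.univ)) := by
    have := (FiniteMeasure.continuous_mass (Ω := X)).tendsto μ
    simpa only [FiniteMeasure.ennreal_mass] using ENNReal.tendsto_coe.2 this
  have hlt : q + (μ : Measure X) Gᶜ < (μ : Measure X) Set.univ := by
    rw [← hadd μ]
    exact ENNReal.add_lt_add_right (measure_ne_top _ _) hμ
  have hls := FiniteMeasure.limsup_measure_closed_le_of_tendsto (μs := id) (L := 𝓝 μ) tendsto_id
    hG.isClosed_compl
  obtain ⟨c, hc, hqc⟩ : ∃ c, (μ : Measure X) Gᶜ < c ∧ q + c < (μ : Measure X) Set.univ := by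
    have hcont : Tendsto (fun c => q + c) (𝓝[>] ((μ : Measure X) Gᶜ)) (𝓝 (q + (μ : Measure X) Gᶜ)) :=
      ((continuous_const_add q).tendsto _).mono_left nhdsWithin_le_nhds
    have : (𝓝[>] ((μ : Measure X) Gᶜ)).NeBot := nhdsGT_neBot_of_exists_gt ⟨⊤, measure_lt_top _ _⟩
    exact (eventually_mem_nhdsWithin.and (hcont.eventually_lt_const hlt)).exists
  filter_upwards [hmass.eventually_const_lt hqc, eventually_lt_of_limsup_lt (hls.trans_lt hc)]
    with ν h1 h2
  rw [← hadd ν] at h1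
  by_contra h
  exact absurd h1 (not_lt.2 (add_le_add (not_lt.1 h) h2.le))

/-- A subbasis of the weak topology: finite unions of basic open sets have measure more than a
rational, or the whole space has measure less than a rational. -/
def weakSubbasis (X : Type*) [MeasurableSpace X] [TopologicalSpace X] [SecondCountableTopology X] :
    Set (Set (FiniteMeasure X)) :=
  (fun p : ℚ × Set (Set X) =>
      {μ : FiniteMeasure X | ENNReal.ofReal p.1 < (μ : Measure X) (⋃₀ p.2)}) ''
    (Set.univ ×ˢ {s : Set (Set X) | s.Finite ∧ s ⊆ TopologicalSpace.countableBasis X}) ∪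
  Set.range fun q : ℚ => {μ : FiniteMeasure X | (μ : Measure X) Set.univ < ENNReal.ofReal q}

variable [SecondCountableTopology X]

theorem countable_weakSubbasis {X : Type*} [MeasurableSpace X] [TopologicalSpace X]
    [SecondCountableTopology X] : (weakSubbasis X).Countable := by
  refine Set.Countable.union (Set.Countable.image (Set.countable_univ.prod ?_) _)
    (Set.countable_range _)
  exact Set.countable_ofPred_finite_subset (TopologicalSpace.countable_countableBasis X)

theorem isOpen_sUnion_basis {X : Type*} [TopologicalSpace X] [SecondCountableTopology X]
    {s : Set (Set X)} (hs : s ⊆ TopologicalSpace.countableBasis X) :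
    IsOpen (⋃₀ s) :=
  isOpen_sUnion fun _ ht => TopologicalSpace.isOpen_of_mem_countableBasis (hs ht)

/-- Continuity from below along an enumeration of the basic sets inside `G`; this is why finite
unions suffice in `weakSubbasis`. -/
theorem exists_finite_lt_measure {X : Type*} [MeasurableSpace X] [TopologicalSpace X]
    [SecondCountableTopology X] {G : Set X} (hG : IsOpen G) (μ : Measure X) {a : ℝ≥0∞}
    (ha : a < μ G) :
    ∃ s : Set (Set X), s.Finite ∧ s ⊆ TopologicalSpace.countableBasis X ∧ ⋃₀ s ⊆ G ∧
      a < μ (⋃₀ s) := by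
  obtain ⟨S, hS, rfl⟩ :=
    (TopologicalSpace.isBasis_countableBasis X).open_eq_sUnion hG
  have hSc : S.Countable := (TopologicalSpace.countable_countableBasis X).mono hS
  rcases S.eq_empty_or_nonempty with rfl | hne
  · simp at ha
  obtain ⟨e, rfl⟩ := hSc.exists_eq_range hne
  rw [Set.sUnion_range, ← Set.iUnion_accumulate,
    (Set.monotone_accumulate).measure_iUnion] at ha
  obtain ⟨n, hn⟩ := lt_iSup_iff.1 ha
  refine ⟨e '' Set.Iic n, (Set.finite_Iic n).image e, ?_, ?_, ?_⟩
  · exact (Set.image_subset_range _ _).trans hS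
  · exact Set.sUnion_subset_sUnion (Set.image_subset_range _ _)
  · rw [Set.sUnion_image]
    exact hn

/-- The nontrivial inclusion is continuity of the identity from the generated topology to the weak
one. The generated topology is second countable, so sequences suffice, and for them
`tendsto_of_forall_isOpen_le_liminf` applies. -/
theorem generateFrom_weakSubbasis [HasOuterApproxClosed X] :
    (FiniteMeasure.instTopologicalSpace : TopologicalSpace (FiniteMeasure X)) =
      TopologicalSpace.generateFrom (weakSubbasis X) := by
  refine le_antisymm (le_generateFrom ?_) ?_
  · rintro _ (⟨⟨q, s⟩, ⟨-, -, hs⟩, rfl⟩ | ⟨q, rfl⟩)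
    · exact isOpen_setOf_lt_measure (isOpen_sUnion_basis hs) _
    · have : Continuous fun μ : FiniteMeasure X => (μ : Measure X) Set.univ := by
        simpa only [Function.comp_def, FiniteMeasure.ennreal_mass] using
          ENNReal.continuous_coe.comp (FiniteMeasure.continuous_mass (Ω := X))
      exact isOpen_lt this continuous_const
  · let T : TopologicalSpace (FiniteMeasure X) := TopologicalSpace.generateFrom (weakSubbasis X)
    have : @SecondCountableTopology (FiniteMeasure X) T :=
      ⟨⟨weakSubbasis X, countable_weakSubbasis, rfl⟩⟩
    refine continuous_id_iff_le.1 ((@continuous_iff_seqContinuous (FiniteMeasure X) (FiniteMeasure X)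
      T FiniteMeasure.instTopologicalSpace _ id).2 ?_)
    intro μs μ hμ
    have hsub : ∀ V ∈ weakSubbasis X, μ ∈ V → ∀ᶠ i in atTop, μs i ∈ V := fun V hV hm =>
      hμ.eventually_mem ((TopologicalSpace.isOpen_generateFrom_of_mem hV).mem_nhds hm)
    have hlow : ∀ G, IsOpen G → ∀ a, a < (μ : Measure X) G →
        ∀ᶠ i in atTop, a < (μs i : Measure X) G := by
      intro G hG a ha
      obtain ⟨s, hsf, hsb, hsG, has⟩ := exists_finite_lt_measure hG _ ha
      obtain ⟨q, hq, h1, h2⟩ := ENNReal.lt_iff_exists_rat_btwn.1 has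
      filter_upwards [hsub _ (Or.inl ⟨(q, s), ⟨trivial, hsf, hsb⟩, rfl⟩) h2] with i hi
      exact (h1.trans hi).trans_le (measure_mono hsG)
    refine tendsto_of_forall_isOpen_le_liminf (tendsto_order.2 ⟨hlow _ isOpen_univ, ?_⟩) ?_
    · intro a ha
      obtain ⟨q, hq, h1, h2⟩ := ENNReal.lt_iff_exists_rat_btwn.1 ha
      filter_upwards [hsub _ (Or.inr ⟨q, rfl⟩) h1] with i hi
      exact hi.trans h2
    · intro G hG
      refine le_of_forall_lt fun a ha => ?_
      obtain ⟨b, hab, hb⟩ := exists_between ha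
      exact hab.trans_le (le_liminf_of_le (by isBoundedDefault) ((hlow G hG b hb).mono fun i => le_of_lt))

instance secondCountableTopology_finiteMeasure [HasOuterApproxClosed X] :
    SecondCountableTopology (FiniteMeasure X) :=
  ⟨⟨weakSubbasis X, countable_weakSubbasis, generateFrom_weakSubbasis⟩⟩

/-- Weakly open sets are measurable for the sigma-algebra generated by the evaluations. -/
instance opensMeasurableSpace_finiteMeasure [HasOuterApproxClosed X] :
    OpensMeasurableSpace (FiniteMeasure X) := by
  refine ⟨?_⟩
  rw [borel_eq_generateFrom_of_subbasis generateFrom_weakSubbasis]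
  refine MeasurableSpace.generateFrom_le ?_
  rintro _ (⟨⟨q, s⟩, ⟨-, -, hs⟩, rfl⟩ | ⟨q, rfl⟩)
  · exact measurableSet_lt measurable_const
      ((Measure.measurable_coe (isOpen_sUnion_basis hs).measurableSet).comp measurable_subtype_coe)
  · exact measurableSet_lt ((Measure.measurable_coe MeasurableSet.univ).comp measurable_subtype_coe)
      measurable_const

end FiniteMeasureTopology

/-! ### Measurability of the computation iterated degree measures -/

instance (X : Type) [MeasurableSpace X] [TopologicalSpace X] [OpensMeasurableSpace X]
    [SecondCountableTopology X] [HasOuterApproxClosed X] : SecondCountableTopology (SubProb X) :=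
  Topology.IsInducing.subtypeVal.secondCountableTopology

instance (X : Type) [MeasurableSpace X] [TopologicalSpace X] [OpensMeasurableSpace X]
    [SecondCountableTopology X] [HasOuterApproxClosed X] : OpensMeasurableSpace (SubProb X) :=
  Subtype.opensMeasurableSpace {μ : FiniteMeasure X | μ.mass ≤ 1}

/-- The two properties travel together: they make the space pseudometrizable, so that closed sets
are approximable by continuous functions, which the next level of the tower needs. -/
theorem idm_secondCountable_regular (d : ℕ) (r : ℝ) (L : ℕ) :
    SecondCountableTopology (IDM d r L) ∧ RegularSpace (IDM d r L) := by
  induction L with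
  | zero =>
    exact ⟨inferInstanceAs (SecondCountableTopology (AttrBall d r)),
      inferInstanceAs (RegularSpace (AttrBall d r))⟩
  | succ L ih =>
    obtain ⟨h1, h2⟩ := ih
    exact ⟨inferInstanceAs (SecondCountableTopology (IDM d r L × SubProb (IDM d r L))),
      inferInstanceAs (RegularSpace (IDM d r L × SubProb (IDM d r L)))⟩

instance (d : ℕ) (r : ℝ) (L : ℕ) : SecondCountableTopology (IDM d r L) :=
  (idm_secondCountable_regular d r L).1

instance (d : ℕ) (r : ℝ) (L : ℕ) : RegularSpace (IDM d r L) :=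
  (idm_secondCountable_regular d r L).2

namespace GraphonSignal

variable {d : ℕ} {r : ℝ}

theorem measurable_uncurry_W (Q : GraphonSignal d r) :
    Measurable fun p : I × I => ENNReal.ofReal (Q.W p.1 p.2) :=
  Q.measurable_W.ennreal_ofReal

theorem measurable_W_right (Q : GraphonSignal d r) (x : I) :
    Measurable fun y => ENNReal.ofReal (Q.W x y) :=
  Q.measurable_uncurry_W.comp measurable_prodMk_left

theorem measurable_aggregate (Q : GraphonSignal d r) {X : Type} [MeasurableSpace X] {g : I → X}
    (hg : Measurable g) : Measurable (Q.aggregate g) := by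
  refine Measurable.subtype_mk (Measurable.subtype_mk (Measure.measurable_of_measurable_coe _ ?_))
  intro s hs
  have h : ∀ x, ((volume : Measure I).withDensity (fun y => ENNReal.ofReal (Q.W x y))).map g s =
      ∫⁻ y in g ⁻¹' s, ENNReal.ofReal (Q.W x y) := fun x => by
    rw [Measure.map_apply hg hs, withDensity_apply _ (hg hs)]
  simp only [h]
  exact Q.measurable_uncurry_W.lintegral_prod_right'

/-- Indispensable because `Measure.map` returns `0` on maps that are not a.e. measurable. -/
theorem measurable_compIDM (Q : GraphonSignal d r) (L : ℕ) : Measurable (Q.compIDM L) := by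
  induction L with
  | zero => exact Q.measurable_f
  | succ L ih =>
    -- Measurability is immediate for the product sigma-algebra; the tower carries the Borel one,
    -- which is contained in it.
    have h : @Measurable I (IDM d r L × SubProb (IDM d r L)) _ Prod.instMeasurableSpace
        (Q.compIDM (L + 1)) := ih.prodMk (Q.measurable_aggregate ih)
    exact h.mono le_rfl
      (OpensMeasurableSpace.borel_le (α := IDM d r L × SubProb (IDM d r L)))

end GraphonSignal

/-! ### Upper bounds for unbalanced optimal transport -/

/-- A common part `κ` of two measures extends to a coupling whose cost is that of `κ` up to a
multiple of the masses that `κ` misses. -/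
theorem unbalancedOT_le_of_partial {X : Type} [MeasurableSpace X] {D : X → X → ℝ≥0∞} {C : ℝ≥0∞}
    (hC : ∀ x y, D x y ≤ C) (μ ν : FiniteMeasure X) (κ : Measure (X × X)) [IsFiniteMeasure κ]
    (μr νr : Measure X) [IsFiniteMeasure μr] [IsFiniteMeasure νr]
    (hμ : (μ : Measure X) = κ.map Prod.fst + μr) (hν : (ν : Measure X) = κ.map Prod.snd + νr) :
    unbalancedOT D μ ν ≤
      ∫⁻ p, D p.1 p.2 ∂κ + (C + 1) * (μr Set.univ + νr Set.univ) := by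
  set a := μr Set.univ with ha
  set b := νr Set.univ with hb
  set k := κ Set.univ with hk
  have hat : a ≠ ∞ := measure_ne_top _ _
  have hbt : b ≠ ∞ := measure_ne_top _ _
  have hkt : k ≠ ∞ := measure_ne_top _ _
  have hμm : (μ.mass : ℝ≥0∞) = k + a := by
    rw [FiniteMeasure.ennreal_mass, hμ, Measure.add_apply,
      Measure.map_apply measurable_fst MeasurableSet.univ, Set.preimage_univ]
  have hνm : (ν.mass : ℝ≥0∞) = k + b := by
    rw [FiniteMeasure.ennreal_mass, hν, Measure.add_apply,
      Measure.map_apply measurable_snd MeasurableSet.univ, Set.preimage_univ]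
  -- The leftovers are coupled independently, normalised by the larger mass: the lighter leftover is
  -- used up, the heavier one only in part.
  set γ : Measure (X × X) := κ + (max a b)⁻¹ • μr.prod νr with hγ
  have hfst : γ.map Prod.fst = κ.map Prod.fst + ((max a b)⁻¹ * b) • μr := by
    rw [hγ, Measure.map_add _ _ measurable_fst, Measure.map_smul, Measure.map_fst_prod, smul_smul]
  have hsnd : γ.map Prod.snd = κ.map Prod.snd + ((max a b)⁻¹ * a) • νr := by
    rw [hγ, Measure.map_add _ _ measurable_snd, Measure.map_smul, Measure.map_snd_prod, smul_smul]
  have hcle : ∀ t, t ≤ max a b → (max a b)⁻¹ * t ≤ 1 := fun t ht =>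
    (mul_le_mul_right ht _).trans (ENNReal.inv_mul_le_one _)
  have hsmul : ∀ (c : ℝ≥0∞) (m : Measure X), c ≤ 1 → c • m ≤ m := fun c m hc =>
    Measure.le_iff.2 fun s _ => by
      rw [Measure.smul_apply, smul_eq_mul]
      exact mul_le_of_le_one_left' hc
  -- For `t = 0` the factor is `∞ * 0 = 0` rather than `1`, but then `m` is the zero measure.
  have hone : ∀ (s t : ℝ≥0∞) (m : Measure X), m Set.univ = s → s ≤ t → t ≠ ∞ →
      (t⁻¹ * t) • m = m := fun s t m hm hst ht => by
    by_cases h0 : t = 0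
    · have : m = 0 := Measure.measure_univ_eq_zero.1 (by rw [hm]; exact le_antisymm (h0 ▸ hst) bot_le)
      simp [this]
    · rw [ENNReal.inv_mul_cancel h0 ht, one_smul]
  have hcoup : IsCoupling γ μ ν := by
    refine ⟨fun h => ⟨?_, ?_⟩, fun h => ⟨?_, ?_⟩⟩
    · have hab : a ≤ b := by
        have : (μ.mass : ℝ≥0∞) ≤ ν.mass := by exact_mod_cast h
        rw [hμm, hνm] at this
        exact (ENNReal.add_le_add_iff_left hkt).1 this
      rw [hfst, hμ, max_eq_right hab, hone a b μr rfl hab hbt]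
    · rw [hsnd, hν]
      exact add_le_add le_rfl (hsmul _ _ (hcle _ (le_max_left _ _)))
    · rw [hfst, hμ]
      exact add_le_add le_rfl (hsmul _ _ (hcle _ (le_max_right _ _)))
    · have hab : b ≤ a := by
        have : (ν.mass : ℝ≥0∞) ≤ μ.mass := by exact_mod_cast h
        rw [hμm, hνm] at this
        exact (ENNReal.add_le_add_iff_left hkt).1 this
      rw [hsnd, hν, max_eq_left hab, hone b a νr rfl hab hat]
  have hcost : ∫⁻ p, D p.1 p.2 ∂γ ≤ ∫⁻ p, D p.1 p.2 ∂κ + C * (a + b) := by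
    rw [hγ, lintegral_add_measure, lintegral_smul_measure, smul_eq_mul]
    refine add_le_add le_rfl ?_
    calc (max a b)⁻¹ * ∫⁻ p, D p.1 p.2 ∂(μr.prod νr)
        ≤ (max a b)⁻¹ * ∫⁻ _, C ∂(μr.prod νr) := by gcongr; exact hC _ _
      _ = C * (((max a b)⁻¹ * b) * a) := by
          rw [lintegral_const, ← Set.univ_prod_univ, Measure.prod_prod]; ring
      _ ≤ C * (1 * a) := by gcongr; exact hcle _ (le_max_right _ _)
      _ ≤ C * (a + b) := by rw [one_mul]; gcongr; exact le_self_add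
  have hmass : ENNReal.ofReal |(μ.mass : ℝ) - (ν.mass : ℝ)| ≤ a + b := by
    have h1 : (μ.mass : ℝ) = k.toReal + a.toReal := by
      rw [← ENNReal.toReal_add hkt hat, ← hμm, ENNReal.coe_toReal]
    have h2 : (ν.mass : ℝ) = k.toReal + b.toReal := by
      rw [← ENNReal.toReal_add hkt hbt, ← hνm, ENNReal.coe_toReal]
    rw [ENNReal.ofReal_le_iff_le_toReal (by simp [hat, hbt]), ENNReal.toReal_add hat hbt, h1, h2,
      abs_le]
    have := ENNReal.toReal_nonneg (a := a)
    have := ENNReal.toReal_nonneg (a := b)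
    constructor <;> linarith
  calc unbalancedOT D μ ν ≤ ∫⁻ p, D p.1 p.2 ∂γ + (a + b) :=
        add_le_add (iInf₂_le γ hcoup) hmass
    _ ≤ ∫⁻ p, D p.1 p.2 ∂κ + C * (a + b) + (a + b) := by gcongr
    _ = _ := by ring

theorem unbalancedOT_le_of_bound {X : Type} [MeasurableSpace X] {D : X → X → ℝ≥0∞} {C : ℝ≥0∞}
    (hC : ∀ x y, D x y ≤ C) (μ ν : FiniteMeasure X) (hμ : μ.mass ≤ 1) (hν : ν.mass ≤ 1) :
    unbalancedOT D μ ν ≤ (C + 1) * 2 := by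
  refine (unbalancedOT_le_of_partial hC μ ν 0 μ ν (by simp) (by simp)).trans ?_
  rw [lintegral_zero_measure, zero_add, ← FiniteMeasure.ennreal_mass, ← FiniteMeasure.ennreal_mass,
    ← one_add_one_eq_two]
  gcongr <;> exact_mod_cast ‹_›

/-- The left side is `a - min a b`, the mass of a block that normalised independent coupling leaves
unmatched. -/
theorem one_sub_inv_max_mul_mul_le {a b η : ℝ≥0∞} (ha : a ≠ ∞) (hb : b ≠ ∞) (h : a ≤ b + η) :
    (1 - (max a b)⁻¹ * b) * a ≤ η := by
  by_cases h0 : a = 0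
  · simp [h0]
  rw [ENNReal.sub_mul (fun _ _ => ha), one_mul, tsub_le_iff_right]
  rcases le_total a b with hab | hab
  · rw [max_eq_right hab, ENNReal.inv_mul_cancel (fun hb0 => h0 (le_antisymm (hb0 ▸ hab) bot_le)) hb,
      one_mul]
    exact le_add_self
  · rw [max_eq_left hab, mul_right_comm, ENNReal.inv_mul_cancel h0 ha, one_mul, add_comm]
    exact h

theorem sum_restrict_eq {Ω ι : Type*} [MeasurableSpace Ω] [Fintype ι] (u : Measure Ω)
    {B : ι → Set Ω} (hB : ∀ j, MeasurableSet (B j)) (hd : Pairwise (Function.onFun Disjoint B))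
    (hu : u (⋃ j, B j)ᶜ = 0) : ∑ j, u.restrict (B j) = u := by
  rw [← Measure.sum_fintype, ← Measure.restrict_iUnion hd hB,
    Measure.restrict_eq_self_of_ae_mem (s := ⋃ j, B j) (mem_ae_iff.2 hu)]

theorem map_fintype_sum {Y Z ι : Type*} [MeasurableSpace Y] [MeasurableSpace Z] [Fintype ι]
    {f : Y → Z} (hf : Measurable f) (w : ι → Measure Y) : (∑ j, w j).map f = ∑ j, (w j).map f := by
  simpa [Measure.mapₗ_apply_of_measurable hf] using map_sum (Measure.mapₗ f) w Finset.univ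

/-- Transport between two push-forwards block by block: within a block the ground distance is at
most `E`, and the masses of each block differ by at most `η`. -/
theorem unbalancedOT_map_le_of_blocks {X : Type} [MeasurableSpace X] {D : X → X → ℝ≥0∞} {C : ℝ≥0∞}
    (hC : ∀ x y, D x y ≤ C) {Ω ι : Type*} [MeasurableSpace Ω] [Fintype ι]
    {B : ι → Set Ω} (hB : ∀ j, MeasurableSet (B j)) (hd : Pairwise (Function.onFun Disjoint B))
    (u v : Measure Ω) [IsFiniteMeasure u] [IsFiniteMeasure v]
    (hu : u (⋃ j, B j)ᶜ = 0) (hv : v (⋃ j, B j)ᶜ = 0)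
    {g g' : Ω → X} (hg : Measurable g) (hg' : Measurable g')
    {E : Ω → ℝ≥0∞} (hE : Measurable E)
    (hDE : ∀ j, ∀ y ∈ B j, ∀ y' ∈ B j, D (g y) (g' y') ≤ E y)
    (η : ι → ℝ≥0∞) (huv : ∀ j, u (B j) ≤ v (B j) + η j) (hvu : ∀ j, v (B j) ≤ u (B j) + η j)
    (μ ν : FiniteMeasure X) (hμ : (μ : Measure X) = u.map g) (hν : (ν : Measure X) = v.map g') :
    unbalancedOT D μ ν ≤ ∫⁻ y, E y ∂u + (C + 1) * (2 * ∑ j, η j) := by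
  set m : ι → ℝ≥0∞ := fun j => (max (u (B j)) (v (B j)))⁻¹ with hm
  have hmu : ∀ j, m j * u (B j) ≤ 1 := fun j =>
    (mul_le_mul_right (le_max_left _ _) _).trans (ENNReal.inv_mul_le_one _)
  have hmv : ∀ j, m j * v (B j) ≤ 1 := fun j =>
    (mul_le_mul_right (le_max_right _ _) _).trans (ENNReal.inv_mul_le_one _)
  have hgg : Measurable (Prod.map g g') := hg.prodMap hg'
  -- On each block the independent coupling, normalised by the larger mass, exhausts the lighter of
  -- the two restrictions.
  set κ : Measure (X × X) := ∑ j, m j •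
    ((u.restrict (B j)).prod (v.restrict (B j))).map (Prod.map g g') with hκ
  set μr : Measure X := ∑ j, (1 - m j * v (B j)) • (u.restrict (B j)).map g with hμr
  set νr : Measure X := ∑ j, (1 - m j * u (B j)) • (v.restrict (B j)).map g' with hνr
  have h1 : (μ : Measure X) = κ.map Prod.fst + μr := by
    rw [hμ, ← sum_restrict_eq u hB hd hu, map_fintype_sum hg, hκ, map_fintype_sum measurable_fst, hμr,
      ← Finset.sum_add_distrib]
    refine Finset.sum_congr rfl fun j _ => ?_
    have : Prod.fst ∘ Prod.map g g' = g ∘ Prod.fst := rfl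
    rw [Measure.map_smul, Measure.map_map measurable_fst hgg, this,
      ← Measure.map_map hg measurable_fst, Measure.map_fst_prod, Measure.map_smul,
      Measure.restrict_apply_univ, smul_smul, ← add_smul, add_tsub_cancel_of_le (hmv j), one_smul]
  have h2 : (ν : Measure X) = κ.map Prod.snd + νr := by
    rw [hν, ← sum_restrict_eq v hB hd hv, map_fintype_sum hg', hκ, map_fintype_sum measurable_snd, hνr,
      ← Finset.sum_add_distrib]
    refine Finset.sum_congr rfl fun j _ => ?_
    have : Prod.snd ∘ Prod.map g g' = g' ∘ Prod.snd := rfl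
    rw [Measure.map_smul, Measure.map_map measurable_snd hgg, this,
      ← Measure.map_map hg' measurable_snd, Measure.map_snd_prod, Measure.map_smul,
      Measure.restrict_apply_univ, smul_smul, ← add_smul, add_tsub_cancel_of_le (hmu j), one_smul]
  have hμrle : μr Set.univ ≤ ∑ j, η j := by
    rw [hμr, Measure.finsetSum_apply]
    refine Finset.sum_le_sum fun j _ => ?_
    rw [Measure.smul_apply, Measure.map_apply hg MeasurableSet.univ, Set.preimage_univ,
      Measure.restrict_apply_univ, smul_eq_mul]
    exact one_sub_inv_max_mul_mul_le (measure_ne_top _ _) (measure_ne_top _ _) (huv j)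
  have hνrle : νr Set.univ ≤ ∑ j, η j := by
    rw [hνr, Measure.finsetSum_apply]
    refine Finset.sum_le_sum fun j _ => ?_
    rw [Measure.smul_apply, Measure.map_apply hg' MeasurableSet.univ, Set.preimage_univ,
      Measure.restrict_apply_univ, smul_eq_mul]
    simp only [hm, max_comm (u (B j))]
    exact one_sub_inv_max_mul_mul_le (measure_ne_top _ _) (measure_ne_top _ _) (hvu j)
  have hfinμ : IsFiniteMeasure μr := isFiniteMeasure_of_le (μ : Measure X) (h1 ▸ Measure.le_add_left le_rfl)
  have hfinν : IsFiniteMeasure νr := isFiniteMeasure_of_le (ν : Measure X) (h2 ▸ Measure.le_add_left le_rfl)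
  have hfinκ : IsFiniteMeasure κ := by
    have : IsFiniteMeasure (κ.map Prod.fst) :=
      isFiniteMeasure_of_le (μ : Measure X) (h1 ▸ Measure.le_add_right le_rfl)
    refine ⟨?_⟩
    have := measure_lt_top (κ.map Prod.fst) Set.univ
    rwa [Measure.map_apply measurable_fst MeasurableSet.univ, Set.preimage_univ] at this
  refine (unbalancedOT_le_of_partial hC μ ν κ μr νr h1 h2).trans (add_le_add ?_ ?_)
  · rw [hκ, lintegral_finsetSum_measure]
    calc ∑ j, ∫⁻ p, D p.1 p.2 ∂(m j •
            ((u.restrict (B j)).prod (v.restrict (B j))).map (Prod.map g g'))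
        ≤ ∑ j, ∫⁻ y in B j, E y ∂u := Finset.sum_le_sum fun j _ => by
          rw [lintegral_smul_measure, smul_eq_mul]
          calc m j * ∫⁻ p, D p.1 p.2 ∂((u.restrict (B j)).prod (v.restrict (B j))).map (Prod.map g g')
              ≤ m j * ∫⁻ p, D (g p.1) (g' p.2) ∂((u.restrict (B j)).prod (v.restrict (B j))) := by
                gcongr
                -- `D` is not assumed measurable, so change of variables is only an inequality, in
                -- the direction needed. The measurable majorant `E` takes over before Fubini.
                exact lintegral_map_le (fun p : X × X => D p.1 p.2) _
            _ ≤ m j * ∫⁻ p, E p.1 ∂((u.restrict (B j)).prod (v.restrict (B j))) := by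
                gcongr m j * ?_
                refine lintegral_mono_ae ?_
                rw [Measure.prod_restrict]
                filter_upwards [ae_restrict_mem ((hB j).prod (hB j))] with p hp
                exact hDE j _ hp.1 _ hp.2
            _ = (m j * v (B j)) * ∫⁻ y in B j, E y ∂u := by
                rw [lintegral_prod (fun p : Ω × Ω => E p.1) (hE.comp measurable_fst).aemeasurable]
                simp only [lintegral_const, Measure.restrict_apply_univ]
                rw [lintegral_mul_const _ hE]
                ring
            _ ≤ ∫⁻ y in B j, E y ∂u := mul_le_of_le_one_left' (hmv j)
      _ = ∫⁻ y, E y ∂u := by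
          rw [← lintegral_finsetSum_measure, sum_restrict_eq u hB hd hu]
  · gcongr
    rw [two_mul]
    exact add_le_add hμrle hνrle

/-! ### Stability of the computation iterated degree measures -/

/-- A finite diameter makes unmatched mass cost at most a constant multiple of itself. -/
theorem exists_idmDist_le (d : ℕ) (r : ℝ) (L : ℕ) :
    ∃ C : ℝ≥0∞, C ≠ ∞ ∧ ∀ x y, idmDist d r L x y ≤ C := by
  induction L with
  | zero =>
    refine ⟨Metric.ediam (Metric.closedBall (0 : EuclideanSpace ℝ (Fin d)) r),
      Metric.isBounded_closedBall.ediam_ne_top, fun x y => ?_⟩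
    exact Metric.edist_le_ediam_of_mem (Subtype.property (p := (· ∈ Metric.closedBall _ r)) x)
      (Subtype.property (p := (· ∈ Metric.closedBall _ r)) y)
  | succ L ih =>
    obtain ⟨C, hC, h⟩ := ih
    refine ⟨C + (C + 1) * 2, by finiteness, fun x y => ?_⟩
    exact add_le_add (h _ _) (unbalancedOT_le_of_bound h _ _ (Prod.snd x).2 (Prod.snd y).2)

namespace GraphonSignal

variable {d : ℕ} {r : ℝ}

/-- The measure with density `W(x, ·)`. -/
def rowMeasure (Q : GraphonSignal d r) (x : I) : Measure I :=
  (volume : Measure I).withDensity fun y => ENNReal.ofReal (Q.W x y)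

theorem rowMeasure_le (Q : GraphonSignal d r) (x : I) : Q.rowMeasure x ≤ volume := by
  conv_rhs => rw [← withDensity_one (μ := (volume : Measure I))]
  exact withDensity_mono (Filter.Eventually.of_forall fun y =>
    ENNReal.ofReal_le_one.2 (Q.le_one_W x y))

instance (Q : GraphonSignal d r) (x : I) : IsFiniteMeasure (Q.rowMeasure x) :=
  isFiniteMeasure_of_le _ (Q.rowMeasure_le x)

/-- `Q` and `Q'` are compared on a partition into blocks: within a block, signals differ by at most
`E₀`, and the degrees into all blocks differ in total by at most `e`. -/
structure BlockClose (Q Q' : GraphonSignal d r) {ι : Type} [Fintype ι] (B : ι → Set I)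
    (E₀ e : I → ℝ≥0∞) : Prop where
  measurableSet_block : ∀ j, MeasurableSet (B j)
  disjoint_block : Pairwise (Function.onFun Disjoint B)
  cover : volume (⋃ j, B j)ᶜ = 0
  measurable_signalError : Measurable E₀
  measurable_degreeError : Measurable e
  signal_le : ∀ i, ∀ x ∈ B i, ∀ x' ∈ B i, idmDist d r 0 (Q.f x) (Q'.f x') ≤ E₀ x
  degree_le : ∀ i, ∀ x ∈ B i, ∀ x' ∈ B i, ∃ η : ι → ℝ≥0∞,
    (∀ j, Q.rowMeasure x (B j) ≤ Q'.rowMeasure x' (B j) + η j) ∧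
    (∀ j, Q'.rowMeasure x' (B j) ≤ Q.rowMeasure x (B j) + η j) ∧ ∑ j, η j ≤ e x

/-- The new coordinate compares push-forwards of row measures. Transport by blocks costs the
integral of the old error against a row measure, hence at most its Lebesgue integral as `W ≤ 1`,
plus a multiple of the degree error. `A` is chosen before the graphons and the partition, so these
may be adapted to it. -/
theorem exists_idmDist_compIDM_le (d : ℕ) (r : ℝ) (L : ℕ) :
    ∃ A : ℝ≥0∞, A ≠ ∞ ∧ ∀ (Q Q' : GraphonSignal d r) {ι : Type} [Fintype ι] (B : ι → Set I)
      (E₀ e : I → ℝ≥0∞), BlockClose Q Q' B E₀ e →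
      ∃ E : I → ℝ≥0∞, Measurable E ∧
        (∀ i, ∀ x ∈ B i, ∀ x' ∈ B i, idmDist d r L (Q.compIDM L x) (Q'.compIDM L x') ≤ E x) ∧
        ∫⁻ x, E x ≤ A * ((∫⁻ x, E₀ x) + ∫⁻ x, e x) := by
  induction L with
  | zero =>
    refine ⟨1, ENNReal.one_ne_top, fun Q Q' ι _ B E₀ e h =>
      ⟨E₀, h.measurable_signalError, h.signal_le, ?_⟩⟩
    rw [one_mul]
    exact le_self_add
  | succ L ih =>
    obtain ⟨A, hA, ih⟩ := ih
    obtain ⟨C, hC, hdist⟩ := exists_idmDist_le d r L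
    refine ⟨2 * A + (C + 1) * 2, by finiteness, fun Q Q' ι _ B E₀ e h => ?_⟩
    obtain ⟨E, hE, hle, hint⟩ := ih Q Q' B E₀ e h
    refine ⟨fun x => E x + ((∫⁻ y, E y) + (C + 1) * (2 * e x)), ?_, ?_, ?_⟩
    · exact hE.add (measurable_const.add
        (measurable_const.mul (measurable_const.mul h.measurable_degreeError)))
    · intro i x hx x' hx'
      obtain ⟨η, h1, h2, h3⟩ := h.degree_le i x hx x' hx'
      have hcov : ∀ (P : GraphonSignal d r) (z : I), P.rowMeasure z (⋃ j, B j)ᶜ = 0 := fun P z =>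
        le_antisymm ((P.rowMeasure_le z _).trans h.cover.le) bot_le
      refine add_le_add (hle i x hx x' hx') ?_
      refine (unbalancedOT_map_le_of_blocks hdist h.measurableSet_block h.disjoint_block
        (Q.rowMeasure x) (Q'.rowMeasure x') (hcov Q x) (hcov Q' x') (Q.measurable_compIDM L)
        (Q'.measurable_compIDM L) hE hle η h1 h2 (Q.aggregate (Q.compIDM L) x).1
        (Q'.aggregate (Q'.compIDM L) x').1 rfl rfl).trans ?_
      gcongr
      exact Q.rowMeasure_le x
    · rw [lintegral_add_left hE, lintegral_add_left measurable_const, lintegral_const,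
        measure_univ, mul_one,
        lintegral_const_mul _ (h.measurable_degreeError.const_mul 2),
        lintegral_const_mul _ h.measurable_degreeError]
      calc (∫⁻ x, E x) + ((∫⁻ x, E x) + (C + 1) * (2 * ∫⁻ x, e x))
          = 2 * (∫⁻ x, E x) + (C + 1) * 2 * ∫⁻ x, e x := by ring
        _ ≤ 2 * (A * ((∫⁻ x, E₀ x) + ∫⁻ x, e x)) +
            (C + 1) * 2 * ((∫⁻ x, E₀ x) + ∫⁻ x, e x) := by
          gcongr
          exact le_add_self
        _ = _ := by ring

/-- The mover's distance is controlled by the errors of a block comparison. -/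
theorem exists_didmDist_le (d : ℕ) (r : ℝ) (L : ℕ) :
    ∃ A : ℝ≥0∞, A ≠ ∞ ∧ ∀ (Q Q' : GraphonSignal d r) {ι : Type} [Fintype ι] (B : ι → Set I)
      (E₀ e : I → ℝ≥0∞), BlockClose Q Q' B E₀ e →
      didmDist L Q Q' ≤ A * ((∫⁻ x, E₀ x) + ∫⁻ x, e x) := by
  obtain ⟨A, hA, hbound⟩ := exists_idmDist_compIDM_le d r L
  obtain ⟨C, hC, hdist⟩ := exists_idmDist_le d r L
  refine ⟨A, hA, fun Q Q' ι _ B E₀ e h => ?_⟩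
  obtain ⟨E, hE, hle, hint⟩ := hbound Q Q' B E₀ e h
  refine le_trans ?_ hint
  -- Both distributions push forward Lebesgue measure, so block masses agree and `η = 0`.
  refine (unbalancedOT_map_le_of_blocks hdist h.measurableSet_block h.disjoint_block
    volume volume h.cover h.cover (Q.measurable_compIDM L) (Q'.measurable_compIDM L) hE hle 0
    (by simp) (by simp) (Q.compDIDM L) (Q'.compDIDM L) rfl rfl).trans ?_
  simp

end GraphonSignal

/-! ### Approximation by step functions -/

/-- A measurable function with values in a compact set is approximated in `L¹` by functions that are
constant on the pieces of any sufficiently fine partition. -/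
theorem exists_step_approx {Ω F : Type*} [PseudoMetricSpace Ω] [CompactSpace Ω] [MeasurableSpace Ω]
    [BorelSpace Ω] (P : Measure Ω) [IsProbabilityMeasure P] [NormedAddCommGroup F] [NormedSpace ℝ F]
    [SecondCountableTopology F] [MeasurableSpace F] [BorelSpace F] {S : Set F} (hS : IsCompact S)
    (hne : S.Nonempty) {f : Ω → F} (hf : Measurable f) (hfS : ∀ x, f x ∈ S) {ε : ℝ≥0∞}
    (hε : ε ≠ 0) :
    ∃ δ : ℝ, 0 < δ ∧ ∀ {ι : Type} (T : ι → Set Ω), (∀ i, ∀ x ∈ T i, ∀ y ∈ T i, dist x y < δ) →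
      ∃ (s : ι → F) (h : Ω → ℝ≥0∞), (∀ i, s i ∈ S) ∧ Measurable h ∧ ∫⁻ x, h x ∂P ≤ ε ∧
        ∀ i, ∀ x ∈ T i, edist (f x) (s i) ≤ h x := by
  -- One quarter for the L¹ error of `g`, one for its oscillation; their sum gets doubled below.
  have hε4 : ε / 4 ≠ 0 := by simp [hε]
  obtain ⟨ρ, hρ0, hρ⟩ := ENNReal.lt_iff_exists_nnreal_btwn.1 (pos_iff_ne_zero.2 hε4)
  have hfint : Integrable f P := by
    obtain ⟨M, hM⟩ := hS.isBounded.exists_norm_le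
    exact Integrable.of_bound hf.aestronglyMeasurable M
      (Filter.Eventually.of_forall fun x => hM _ (hfS x))
  obtain ⟨g, hg, -⟩ := hfint.exists_boundedContinuous_lintegral_sub_le (ε := ε / 4) hε4
  have huc := CompactSpace.uniformContinuous_of_continuous g.continuous
  obtain ⟨δ, hδ, hgδ⟩ := Metric.uniformContinuous_iff.1 huc ρ (by exact_mod_cast hρ0)
  refine ⟨δ, hδ, fun {ι} T hT => ?_⟩
  have hmeas : Measurable fun x => ‖f x - g x‖ₑ :=
    (hf.sub g.continuous.measurable).enorm
  -- The continuous approximation `g` may leave `S`. Replacing its value by a nearest point of `S`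
  -- at most doubles the error, since `f x` lies in `S`.
  have hnear : ∀ z : F, ∃ s ∈ S, ∀ y ∈ S, edist z s ≤ edist z y := fun z => by
    obtain ⟨s, hs, h⟩ := hS.exists_infEDist_eq_edist hne z
    exact ⟨s, hs, fun y hy => h ▸ Metric.infEDist_le_edist_of_mem hy⟩
  have hs : ∀ i, ∃ s ∈ S, ∀ x ∈ T i, edist (f x) s ≤ 2 * (‖f x - g x‖ₑ + ρ) := by
    intro i
    rcases (T i).eq_empty_or_nonempty with h0 | ⟨c, hc⟩
    · exact ⟨hne.some, hne.some_mem, by simp [h0]⟩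
    obtain ⟨s, hs, hmin⟩ := hnear (g c)
    refine ⟨s, hs, fun x hx => ?_⟩
    have h1 : edist (f x) (g c) ≤ ‖f x - g x‖ₑ + ρ := by
      refine (edist_triangle _ (g x) _).trans (add_le_add (edist_eq_enorm_sub _ _).le ?_)
      rw [edist_dist, ← ENNReal.ofReal_coe_nnreal]
      exact ENNReal.ofReal_le_ofReal (hgδ (hT i x hx c hc)).le
    calc edist (f x) s ≤ edist (f x) (g c) + edist (g c) s := edist_triangle _ _ _
      _ ≤ edist (f x) (g c) + edist (f x) (g c) := by
          gcongr
          rw [edist_comm (f x)]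
          exact hmin _ (hfS x)
      _ ≤ _ := by rw [two_mul]; gcongr
  choose s hsS hs using hs
  refine ⟨s, fun x => 2 * (‖f x - g x‖ₑ + ρ), hsS, (hmeas.add_const _).const_mul _, ?_, hs⟩
  rw [lintegral_const_mul _ (hmeas.add_const _), lintegral_add_left hmeas, lintegral_const,
    measure_univ, mul_one]
  calc 2 * ((∫⁻ x, ‖f x - g x‖ₑ ∂P) + ρ) ≤ 2 * (ε / 4 + ε / 4) := by gcongr
    _ = 4 * (ε / 4) := by ring
    _ = ε := ENNReal.mul_div_cancel (by simp) (by simp)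

/-! ### The equipartition of the unit interval -/

theorem disjoint_equiInterval (N : ℕ) : Pairwise (Function.onFun Disjoint (equiInterval N)) :=
  fun _ _ hij => Set.disjoint_left.2 fun _ hi hj => hij (equiInterval_unique hi hj)

theorem exists_mem_equiInterval {N : ℕ} (hN : 0 < N) {x : I} (hx : (x : ℝ) < 1) :
    ∃ i, x ∈ equiInterval N i := by
  have hN' : (0 : ℝ) < N := by exact_mod_cast hN
  have h0 : 0 ≤ (x : ℝ) * N := mul_nonneg x.2.1 hN'.le
  refine ⟨⟨⌊(x : ℝ) * N⌋₊, (Nat.floor_lt h0).2 (by nlinarith)⟩, ?_, ?_⟩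
  · exact (div_le_iff₀ hN').2 (Nat.floor_le h0)
  · exact (lt_div_iff₀ hN').2 (Nat.lt_floor_add_one _)

theorem lt_one_of_mem_equiInterval {N : ℕ} {i : Fin N} {x : I} (hx : x ∈ equiInterval N i) :
    (x : ℝ) < 1 := by
  have hN' : (0 : ℝ) < N := by exact_mod_cast i.pos
  refine hx.2.trans_le ((div_le_one hN').2 ?_)
  exact_mod_cast i.2

theorem volume_compl_iUnion_equiInterval {N : ℕ} (hN : 0 < N) :
    volume (⋃ i, equiInterval N i)ᶜ = 0 := by
  -- The half-open intervals miss only the point `1`.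
  refine measure_mono_null (t := {1}) (fun x hx => ?_) (measure_singleton _)
  by_contra h
  exact hx (Set.mem_iUnion.2 (exists_mem_equiInterval hN (lt_of_le_of_ne x.2.2 fun h' => h
    (Subtype.ext h'))))

theorem volume_equiInterval {N : ℕ} (i : Fin N) : volume (equiInterval N i) = (N : ℝ≥0∞)⁻¹ := by
  have hN' : (0 : ℝ) < N := by exact_mod_cast i.pos
  have h1 : ((i : ℝ) + 1) / N ≤ 1 := (div_le_one hN').2 (by exact_mod_cast i.2)
  have h0 : (i : ℝ) / N ≤ ((i : ℝ) + 1) / N := by gcongr; linarith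
  have : equiInterval N i = Set.Ico (⟨i / N, by positivity, h0.trans h1⟩ : I)
      ⟨(i + 1) / N, by positivity, h1⟩ := rfl
  rw [this, unitInterval.volume_Ico, ← ENNReal.ofReal_natCast, ← ENNReal.ofReal_inv_of_pos hN']
  congr 1
  simp only
  ring

theorem dist_lt_of_mem_equiInterval {N : ℕ} {i : Fin N} {x y : I} (hx : x ∈ equiInterval N i)
    (hy : y ∈ equiInterval N i) : dist x y < 1 / N := by
  obtain ⟨h1, h2⟩ := hx
  obtain ⟨h3, h4⟩ := hy
  rw [add_div] at h2 h4
  rw [Subtype.dist_eq, Real.dist_eq, abs_lt]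
  constructor <;> linarith

theorem mem_equiInterval_divNat {K m : ℕ} {n : Fin (K * m)} {x : I}
    (hx : x ∈ equiInterval (K * m) n) : x ∈ equiInterval K n.divNat := by
  have hKm : 0 < K * m := n.pos
  have hm : (0 : ℝ) < m := by exact_mod_cast Nat.pos_of_mul_pos_left hKm
  have hK : (0 : ℝ) < K := by exact_mod_cast Nat.pos_of_mul_pos_right hKm
  have hKm' : (0 : ℝ) < (K : ℝ) * m := mul_pos hK hm
  have h1 : (n : ℕ) / m * m ≤ n := Nat.div_mul_le_self _ _
  have h2 : (n : ℕ) + 1 ≤ ((n : ℕ) / m + 1) * m :=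
    Nat.lt_mul_of_div_lt (Nat.lt_succ_self _) (by exact_mod_cast hm)
  have h1' : (((n : ℕ) / m : ℕ) : ℝ) * m ≤ n := by exact_mod_cast h1
  have h2' : ((n : ℕ) : ℝ) + 1 ≤ ((((n : ℕ) / m : ℕ) : ℝ) + 1) * m := by exact_mod_cast h2
  obtain ⟨h3, h4⟩ := hx
  rw [Nat.cast_mul] at h3 h4
  constructor
  · refine le_trans ?_ h3
    rw [div_le_div_iff₀ hK hKm', Fin.coe_divNat]
    nlinarith
  · refine h4.trans_le ?_
    rw [div_le_div_iff₀ hKm' hK, Fin.coe_divNat]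
    nlinarith

theorem stepFun_of_mem {E : Type} [AddCommMonoid E] {N : ℕ} (c : Fin N → E) {i : Fin N} {x : I}
    (hx : x ∈ equiInterval N i) : stepFun N c x = c i := by
  unfold stepFun
  rw [Finset.sum_eq_single i, Set.indicator_of_mem hx]
  · intro j _ hji
    exact Set.indicator_of_notMem (fun hj => hji (equiInterval_unique hj hx)) _
  · simp

/-! ### Block graphs -/

/-- Addition in `Fin m` is modulo `m`, so translation by `s` is a permutation. This makes all nodes
of a block have the same degree into another block, up to loops. -/
theorem card_filter_add_lt {m : ℕ} [NeZero m] (s : Fin m) {a : ℕ} (ha : a ≤ m) :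
    (Finset.univ.filter fun t : Fin m => ((s + t : Fin m) : ℕ) < a).card = a := by
  have h : (Finset.univ.filter fun t : Fin m => ((s + t : Fin m) : ℕ) < a).map
      (Equiv.addLeft s).toEmbedding = Finset.univ.filter fun t : Fin m => (t : ℕ) < a := by
    ext t
    simp only [Finset.mem_map_equiv, Finset.mem_filter, Finset.mem_univ, true_and]
    rw [show s + (Equiv.addLeft s).symm t = t from (Equiv.addLeft s).apply_symm_apply t]
  rw [← Finset.card_map, h, Fin.card_filter_val_lt, min_eq_right ha]

theorem GraphSignal.rowMeasure_apply {d : ℕ} {r : ℝ} (G : GraphSignal d r) {n : Fin G.N} {x : I}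
    (hx : x ∈ equiInterval G.N n) {S : Set I} (hS : MeasurableSet S) :
    G.toGraphonSignal.rowMeasure x S =
      ∑ n', ENNReal.ofReal (G.adj n n') * volume (equiInterval G.N n' ∩ S) := by
  have hW : ∀ y, ENNReal.ofReal (G.toGraphonSignal.W x y) =
      ∑ n', (equiInterval G.N n').indicator (fun _ => ENNReal.ofReal (G.adj n n')) y := by
    intro y
    have h1 : G.toGraphonSignal.W x y = stepFun G.N (fun n' => G.adj n n') y :=
      (G.stepGraphon_eq x y).trans (stepFun_of_mem _ hx)
    rw [h1]
    unfold stepFun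
    rw [ENNReal.ofReal_sum_of_nonneg]
    · refine Finset.sum_congr rfl fun n' _ => ?_
      by_cases hy : y ∈ equiInterval G.N n'
      · rw [Set.indicator_of_mem hy, Set.indicator_of_mem hy]
      · rw [Set.indicator_of_notMem hy, Set.indicator_of_notMem hy, ENNReal.ofReal_zero]
    · intro n' _
      refine Set.indicator_nonneg (fun _ _ => ?_) _
      change 0 ≤ G.adj n n'
      unfold GraphSignal.adj
      split_ifs <;> norm_num
  unfold GraphonSignal.rowMeasure
  rw [withDensity_apply _ hS]
  simp only [hW]
  rw [lintegral_finsetSum _ fun n' _ =>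
    measurable_const.indicator (measurableSet_equiInterval _ n')]
  simp only [lintegral_indicator_const (measurableSet_equiInterval _ _),
    Measure.restrict_apply (measurableSet_equiInterval _ _)]

/-- Each of `K` blocks has `m` nodes, and every node of block `i` is adjacent to `a i j` nodes of
block `j`, up to a loop that is left out. -/
def blockSimpleGraph {K m : ℕ} [NeZero m] (a : Fin K → Fin K → ℕ) (ha : ∀ i j, a i j = a j i) :
    SimpleGraph (Fin (K * m)) where
  Adj n n' := n ≠ n' ∧ ((n.modNat + n'.modNat : Fin m) : ℕ) < a n.divNat n'.divNat
  symm := ⟨fun n n' h => ⟨h.1.symm, by rw [add_comm, ha]; exact h.2⟩⟩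
  loopless := ⟨fun n h => h.1 rfl⟩

/-- The block graph with the attribute `s i` on block `i`. -/
def blockGraph {d : ℕ} {r : ℝ} {K m : ℕ} [NeZero m] (hK : 0 < K) (a : Fin K → Fin K → ℕ)
    (ha : ∀ i j, a i j = a j i) (s : Fin K → AttrBall d r) : GraphSignal d r where
  N := K * m
  pos := Nat.mul_pos hK (NeZero.pos m)
  graph := blockSimpleGraph a ha
  signal := fun n => s n.divNat

section BlockGraph

variable {d : ℕ} {r : ℝ} {K m : ℕ} [NeZero m] (hK : 0 < K) {a : Fin K → Fin K → ℕ}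
  (ha : ∀ i j, a i j = a j i) (s : Fin K → AttrBall d r)

theorem exists_node_of_mem {i : Fin K} {x : I} (hx : x ∈ equiInterval K i) :
    ∃ n : Fin (K * m), x ∈ equiInterval (K * m) n ∧ n.divNat = i := by
  obtain ⟨n, hn⟩ := exists_mem_equiInterval (N := K * m) (Nat.mul_pos i.pos (NeZero.pos m))
    (lt_one_of_mem_equiInterval hx)
  exact ⟨n, hn, equiInterval_unique (mem_equiInterval_divNat hn) hx⟩

theorem blockGraph_signal {i : Fin K} {x : I} (hx : x ∈ equiInterval K i) :
    (blockGraph (m := m) hK a ha s).toGraphonSignal.f x = s i := by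
  obtain ⟨n, hn, rfl⟩ := exists_node_of_mem (m := m) hx
  exact Subtype.ext (stepFun_of_mem (N := K * m) _ hn)

open scoped Classical in
theorem blockGraph_rowMeasure {n : Fin (K * m)} {x : I} (hx : x ∈ equiInterval (K * m) n)
    (j : Fin K) :
    (blockGraph (m := m) hK a ha s).toGraphonSignal.rowMeasure x (equiInterval K j) =
      (Finset.univ.filter fun t : Fin m =>
        (blockSimpleGraph a ha).Adj n (finProdFinEquiv (j, t))).card *
        ((K * m : ℕ) : ℝ≥0∞)⁻¹ := by
  have hvol : ∀ n' : Fin (K * m), volume (equiInterval (K * m) n' ∩ equiInterval K j) =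
      if n'.divNat = j then ((K * m : ℕ) : ℝ≥0∞)⁻¹ else 0 := by
    intro n'
    split_ifs with h
    · rw [Set.inter_eq_left.2 fun y hy => h ▸ mem_equiInterval_divNat hy, volume_equiInterval]
    · rw [Set.disjoint_iff_inter_eq_empty.1, measure_empty]
      exact Set.disjoint_left.2 fun y hy hy' =>
        h (equiInterval_unique (mem_equiInterval_divNat hy) hy')
  have h : (blockGraph (m := m) hK a ha s).toGraphonSignal.rowMeasure x (equiInterval K j) =
      ∑ n' : Fin (K * m), ENNReal.ofReal (if (blockSimpleGraph a ha).Adj n n' then 1 else 0) *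
        volume (equiInterval (K * m) n' ∩ equiInterval K j) :=
    (blockGraph (m := m) hK a ha s).rowMeasure_apply hx (measurableSet_equiInterval K j)
  simp only [hvol] at h
  rw [h]
  rw [← finProdFinEquiv.sum_comp, Fintype.sum_prod_type, Finset.sum_eq_single j]
  · have : ∀ t : Fin m, (finProdFinEquiv (j, t)).divNat = j := fun t =>
      congrArg Prod.fst (finProdFinEquiv.symm_apply_apply (j, t))
    simp only [this, if_true]
    rw [← Finset.sum_mul, ← Finset.sum_boole]
    congr 1
    refine Finset.sum_congr rfl fun t _ => ?_
    split_ifs <;> simp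
  · intro j' _ hj'
    refine Finset.sum_eq_zero fun t _ => ?_
    have : (finProdFinEquiv (j', t)).divNat = j' :=
      congrArg Prod.fst (finProdFinEquiv.symm_apply_apply (j', t))
    rw [this, if_neg hj', mul_zero]
  · simp

open scoped Classical in
theorem card_blockSimpleGraph_adj_le (ham : ∀ i j, a i j ≤ m) (n : Fin (K * m)) (j : Fin K) :
    (Finset.univ.filter fun t : Fin m =>
        (blockSimpleGraph a ha).Adj n (finProdFinEquiv (j, t))).card ≤
      a n.divNat j ∧
    a n.divNat j ≤ (Finset.univ.filter fun t : Fin m =>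
        (blockSimpleGraph a ha).Adj n (finProdFinEquiv (j, t))).card + 1 := by
  have hdiv : ∀ t : Fin m, (finProdFinEquiv (j, t)).divNat = j := fun t =>
    congrArg Prod.fst (finProdFinEquiv.symm_apply_apply (j, t))
  have hmod : ∀ t : Fin m, (finProdFinEquiv (j, t)).modNat = t := fun t =>
    congrArg Prod.snd (finProdFinEquiv.symm_apply_apply (j, t))
  have hadj : ∀ t : Fin m, (blockSimpleGraph a ha).Adj n (finProdFinEquiv (j, t)) ↔
      n ≠ finProdFinEquiv (j, t) ∧ ((n.modNat + t : Fin m) : ℕ) < a n.divNat j := by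
    intro t
    change _ ∧ _ ↔ _
    rw [hdiv, hmod]
  simp only [hadj]
  have hcard := card_filter_add_lt n.modNat (ham n.divNat j)
  constructor
  · conv_rhs => rw [← hcard]
    exact Finset.card_le_card (Finset.monotone_filter_right _ fun t _ h => h.2)
  · conv_lhs => rw [← hcard]
    -- At most one neighbour is lost, the loop at `n`, whose index is `n.modNat`.
    refine (Finset.card_le_card (t := insert n.modNat (Finset.univ.filter fun t : Fin m =>
      n ≠ finProdFinEquiv (j, t) ∧ ((n.modNat + t : Fin m) : ℕ) < a n.divNat j)) ?_).trans
      (Finset.card_insert_le _ _)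
    intro t ht
    rw [Finset.mem_insert, Finset.mem_filter]
    by_cases h : n = finProdFinEquiv (j, t)
    · exact Or.inl (by rw [h, hmod])
    · exact Or.inr ⟨Finset.mem_univ _, h, (Finset.mem_filter.1 ht).2⟩

/-- The degree of a node of block `i` into block `j` is that of the constant density `p`, up to an
error of two nodes. -/
theorem blockGraph_rowMeasure_le {p : ℝ} (ham : ∀ i j, a i j ≤ m) {i j : Fin K} {x : I}
    (hx : x ∈ equiInterval K i) (h1 : (a i j : ℝ) ≤ m * p) (h2 : m * p ≤ a i j + 1) :
    (blockGraph (m := m) hK a ha s).toGraphonSignal.rowMeasure x (equiInterval K j) ≤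
      ENNReal.ofReal p * (K : ℝ≥0∞)⁻¹ ∧
    ENNReal.ofReal p * (K : ℝ≥0∞)⁻¹ ≤
      (blockGraph (m := m) hK a ha s).toGraphonSignal.rowMeasure x (equiInterval K j) +
        2 * ((K * m : ℕ) : ℝ≥0∞)⁻¹ := by
  classical
  obtain ⟨n, hn, rfl⟩ := exists_node_of_mem (m := m) hx
  rw [blockGraph_rowMeasure hK ha s hn]
  obtain ⟨c1, c2⟩ := card_blockSimpleGraph_adj_le ha ham n j
  generalize (Finset.univ.filter fun t : Fin m =>
    (blockSimpleGraph a ha).Adj n (finProdFinEquiv (j, t))).card = c at c1 c2 ⊢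
  have hm0 : (m : ℝ≥0∞) ≠ 0 := by exact_mod_cast NeZero.ne m
  have hp : ENNReal.ofReal p * (K : ℝ≥0∞)⁻¹ =
      ENNReal.ofReal (m * p) * ((K * m : ℕ) : ℝ≥0∞)⁻¹ := by
    rw [ENNReal.ofReal_mul (by positivity), ENNReal.ofReal_natCast, Nat.cast_mul,
      ENNReal.mul_inv (Or.inr (by simp)) (Or.inr hm0)]
    calc ENNReal.ofReal p * (K : ℝ≥0∞)⁻¹
        = (m * (m : ℝ≥0∞)⁻¹) * (ENNReal.ofReal p * (K : ℝ≥0∞)⁻¹) := by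
          rw [ENNReal.mul_inv_cancel hm0 (by simp), one_mul]
      _ = _ := by ring
  rw [hp, ← add_mul]
  constructor
  · gcongr
    rw [← ENNReal.ofReal_natCast]
    refine ENNReal.ofReal_le_ofReal (le_trans ?_ h1)
    exact_mod_cast c1
  · gcongr
    have : (c : ℝ≥0∞) + 2 = ENNReal.ofReal ((c : ℝ) + 2) := by
      rw [ENNReal.ofReal_add (by positivity) (by norm_num), ENNReal.ofReal_natCast]; simp
    rw [this]
    -- Of the two nodes of error, one is the rounding of `m * p`, the other the omitted loop.
    refine ENNReal.ofReal_le_ofReal (h2.trans ?_)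
    have : (a n.divNat j : ℝ) ≤ c + 1 := by exact_mod_cast c2
    linarith

end BlockGraph

/-! ### Density of graph-signals -/

namespace GraphonSignal

variable {d : ℕ} {r : ℝ}

/-- On a block where `W(x, ·)` is within `H` of a constant `p`, the degree of `x` into the block is
within the integral of `H` of the degree for the constant density `p`. -/
theorem rowMeasure_near_const (Q : GraphonSignal d r) {K : ℕ} {j : Fin K} {x : I} {p : ℝ}
    {H : I → ℝ≥0∞} (hH : Measurable H)
    (h : ∀ y ∈ equiInterval K j, edist (Q.W x y) p ≤ H y) :
    Q.rowMeasure x (equiInterval K j) ≤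
      ENNReal.ofReal p * (K : ℝ≥0∞)⁻¹ + ∫⁻ y in equiInterval K j, H y ∧
    ENNReal.ofReal p * (K : ℝ≥0∞)⁻¹ ≤
      Q.rowMeasure x (equiInterval K j) + ∫⁻ y in equiInterval K j, H y := by
  have hofReal : ∀ s t : ℝ, ENNReal.ofReal s ≤ ENNReal.ofReal t + edist s t := fun s t => by
    rw [edist_dist]
    refine le_trans (ENNReal.ofReal_le_ofReal ?_) ENNReal.ofReal_add_le
    rw [Real.dist_eq]
    linarith [le_abs_self (s - t)]
  have hconst : ∫⁻ _ in equiInterval K j, ENNReal.ofReal p = ENNReal.ofReal p * (K : ℝ≥0∞)⁻¹ := by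
    rw [lintegral_const, Measure.restrict_apply_univ, volume_equiInterval]
  unfold rowMeasure
  rw [withDensity_apply _ (measurableSet_equiInterval K j), ← hconst]
  constructor
  · rw [← lintegral_add_right _ hH]
    refine setLIntegral_mono' (measurableSet_equiInterval K j) fun y hy => ?_
    exact (hofReal _ _).trans (add_le_add le_rfl (h y hy))
  · rw [← lintegral_add_right _ hH]
    refine setLIntegral_mono' (measurableSet_equiInterval K j) fun y hy => ?_
    refine (hofReal _ (Q.W x y)).trans (add_le_add le_rfl ?_)
    rw [edist_comm]
    exact h y hy

/-- Every graphon-signal is block-close to a graph-signal. -/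
theorem exists_blockClose (hr : 0 < r) (Q : GraphonSignal d r) {θ : ℝ≥0∞} (hθ : θ ≠ 0) :
    ∃ (G : GraphSignal d r) (K : ℕ) (E₀ e : I → ℝ≥0∞),
      BlockClose Q G.toGraphonSignal (equiInterval K) E₀ e ∧
      ∫⁻ x, E₀ x ≤ θ ∧ ∫⁻ x, e x ≤ 3 * θ := by
  obtain ⟨δ₁, hδ₁, happrox₁⟩ := exists_step_approx (volume : Measure I)
    (isCompact_closedBall (0 : EuclideanSpace ℝ (Fin d)) r)
    (Metric.nonempty_closedBall.2 hr.le) (f := fun x => (Q.f x : EuclideanSpace ℝ (Fin d)))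
    (measurable_subtype_coe.comp Q.measurable_f) (fun x => (Q.f x).2) hθ
  obtain ⟨δ₂, hδ₂, happrox₂⟩ := exists_step_approx (volume : Measure (I × I))
    (isCompact_Icc (a := (0 : ℝ)) (b := 1)) (Set.nonempty_Icc.2 zero_le_one)
    (f := fun z => Q.W z.1 z.2) Q.measurable_W (fun z => ⟨Q.nonneg_W _ _, Q.le_one_W _ _⟩) hθ
  obtain ⟨k, hk⟩ := exists_nat_one_div_lt (lt_min hδ₁ hδ₂)
  set K := k + 1 with hKdef
  have hK : 0 < K := Nat.succ_pos k
  have hdist : ∀ i : Fin K, ∀ x ∈ equiInterval K i, ∀ y ∈ equiInterval K i,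
      dist x y < min δ₁ δ₂ := fun i x hx y hy =>
    (dist_lt_of_mem_equiInterval hx hy).trans (by rw [hKdef]; push_cast; exact hk)
  obtain ⟨s, E₀, hs, hE₀, hE₀int, hE₀le⟩ := happrox₁ (equiInterval K)
    fun i x hx y hy => (hdist i x hx y hy).trans_le (min_le_left _ _)
  obtain ⟨q, h, hq, hh, hhint, hhle⟩ := happrox₂
    (fun ij : Fin K × Fin K => equiInterval K ij.1 ×ˢ equiInterval K ij.2)
    fun ij z hz w hw => by
      rw [Prod.dist_eq]
      exact max_lt ((hdist _ _ hz.1 _ hw.1).trans_le (min_le_right _ _))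
        ((hdist _ _ hz.2 _ hw.2).trans_le (min_le_right _ _))
  -- An error of `2 / (K * m)` in each of `K` blocks adds up to `2 / m`, independently of `K`.
  obtain ⟨M, hM⟩ := ENNReal.exists_inv_nat_lt (ENNReal.half_pos hθ).ne'
  set m := M + 1 with hmdef
  have hm : 2 * (m : ℝ≥0∞)⁻¹ ≤ θ := by
    calc 2 * (m : ℝ≥0∞)⁻¹ ≤ 2 * (θ / 2) := by
          gcongr
          refine le_trans ?_ hM.le
          rw [hmdef]
          gcongr
          exact Nat.le_succ M
      _ = θ := ENNReal.mul_div_cancel (by simp) (by simp)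
  -- The values `q` need not be symmetric, so each unordered pair of blocks takes the value of its
  -- ordered representative; symmetry of `W` then bounds the error by `h` plus its swap.
  set p : Fin K → Fin K → ℝ := fun i j => q (min i j, max i j) with hp
  have hp0 : ∀ i j, 0 ≤ p i j := fun i j => (hq _).1
  have hp1 : ∀ i j, p i j ≤ 1 := fun i j => (hq _).2
  have hpsymm : ∀ i j, p i j = p j i := fun i j => by simp only [hp, min_comm, max_comm]
  set a : Fin K → Fin K → ℕ := fun i j => ⌊(m : ℝ) * p i j⌋₊ with ha
  have hasymm : ∀ i j, a i j = a j i := fun i j => by simp only [ha, hpsymm i j]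
  have ham : ∀ i j, a i j ≤ m := fun i j => by
    refine Nat.floor_le_of_le ?_
    exact mul_le_of_le_one_right (by positivity) (hp1 i j)
  set H : I × I → ℝ≥0∞ := fun z => h z + h z.swap with hHdef
  have hH : Measurable H := hh.add (hh.comp measurable_swap)
  have hWp : ∀ i j, ∀ x ∈ equiInterval K i, ∀ y ∈ equiInterval K j,
      edist (Q.W x y) (p i j) ≤ H (x, y) := by
    intro i j x hx y hy
    rcases le_total i j with hij | hij
    · have := hhle (i, j) (x, y) ⟨hx, hy⟩
      simp only [hp, min_eq_left hij, max_eq_right hij]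
      exact this.trans le_self_add
    · have := hhle (j, i) (y, x) ⟨hy, hx⟩
      simp only [hp, min_eq_right hij, max_eq_left hij]
      rw [Q.symm_W x y]
      exact this.trans le_add_self
  have hsection : ∀ x, Measurable fun y => H (x, y) := fun x => hH.comp measurable_prodMk_left
  refine ⟨blockGraph (m := m) hK a hasymm fun i => ⟨s i, hs i⟩, K, E₀,
    fun x => (∫⁻ y, H (x, y)) + 2 * (m : ℝ≥0∞)⁻¹, ?_, hE₀int, ?_⟩
  · refine ⟨measurableSet_equiInterval K, disjoint_equiInterval K,
      volume_compl_iUnion_equiInterval hK, hE₀, hH.lintegral_prod_right'.add_const _, ?_, ?_⟩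
    · intro i x hx x' hx'
      rw [blockGraph_signal hK hasymm _ hx']
      exact hE₀le i x hx
    · intro i x hx x' hx'
      refine ⟨fun j => (∫⁻ y in equiInterval K j, H (x, y)) + 2 * ((K * m : ℕ) : ℝ≥0∞)⁻¹,
        fun j => ?_, fun j => ?_, ?_⟩
      · obtain ⟨h1, -⟩ := Q.rowMeasure_near_const (hsection x) (hWp i j x hx)
        obtain ⟨-, h2⟩ := blockGraph_rowMeasure_le hK hasymm (fun i => ⟨s i, hs i⟩) ham hx'
          (j := j) (Nat.floor_le (mul_nonneg (by positivity) (hp0 i j)))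
          (Nat.lt_floor_add_one _).le
        refine (h1.trans (add_le_add h2 le_rfl)).trans (le_of_eq ?_)
        ring
      · obtain ⟨-, h1⟩ := Q.rowMeasure_near_const (hsection x) (hWp i j x hx)
        obtain ⟨h2, -⟩ := blockGraph_rowMeasure_le hK hasymm (fun i => ⟨s i, hs i⟩) ham hx'
          (j := j) (Nat.floor_le (mul_nonneg (by positivity) (hp0 i j)))
          (Nat.lt_floor_add_one _).le
        refine (h2.trans h1).trans ?_
        gcongr
        exact le_self_add
      · rw [Finset.sum_add_distrib]
        refine add_le_add ?_ ?_
        · rw [← lintegral_finsetSum_measure, sum_restrict_eq volume (measurableSet_equiInterval K)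
            (disjoint_equiInterval K) (volume_compl_iUnion_equiInterval hK)]
        · have hK0 : (K : ℝ≥0∞) ≠ 0 := by exact_mod_cast hK.ne'
          rw [Finset.sum_const, Finset.card_univ, Fintype.card_fin, nsmul_eq_mul, Nat.cast_mul,
            ENNReal.mul_inv (Or.inl hK0) (Or.inl (by simp))]
          refine le_of_eq ?_
          calc (K : ℝ≥0∞) * (2 * ((K : ℝ≥0∞)⁻¹ * (m : ℝ≥0∞)⁻¹))
              = (K * (K : ℝ≥0∞)⁻¹) * (2 * (m : ℝ≥0∞)⁻¹) := by ring
            _ = _ := by rw [ENNReal.mul_inv_cancel hK0 (by simp), one_mul]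
  · have hHint : ∫⁻ x, ∫⁻ y, H (x, y) ≤ 2 * θ := by
      rw [← lintegral_prod _ hH.aemeasurable, hHdef, lintegral_add_left hh,
        lintegral_prod_swap, two_mul]
      exact add_le_add hhint hhint
    rw [lintegral_add_right _ measurable_const, lintegral_const, measure_univ, mul_one]
    calc (∫⁻ x, ∫⁻ y, H (x, y)) + 2 * (m : ℝ≥0∞)⁻¹ ≤ 2 * θ + θ := add_le_add hHint hm
      _ = 3 * θ := by ring

end GraphonSignal

end

theorem mainTheorem10 (d : ℕ) (r : ℝ) (hr : 0 < r) (L : ℕ) (Q : GraphonSignal d r)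
    (ε : ℝ) (hε : 0 < ε) :
    ∃ G : GraphSignal d r, GraphonSignal.didmDist L Q G.toGraphonSignal < ENNReal.ofReal ε := by
  obtain ⟨A, hA, hbound⟩ := GraphonSignal.exists_didmDist_le d r L
  have hε' : ENNReal.ofReal ε / 2 ≠ 0 := by simp [hε]
  have hA4 : (A + 1) * 4 ≠ ∞ := by finiteness
  have hA0 : (A + 1) * 4 ≠ 0 := by simp
  -- The factor `4` is `1 + 3` from the two error bounds, `A + 1` avoids division by zero, and
  -- halving `ε` gives a strict inequality.
  obtain ⟨G, K, E₀, e, hclose, h₀, h₁⟩ := Q.exists_blockClose hr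
    (θ := ENNReal.ofReal ε / 2 / ((A + 1) * 4)) (ENNReal.div_ne_zero.2 ⟨hε', hA4⟩)
  refine ⟨G, ?_⟩
  set θ := ENNReal.ofReal ε / 2 / ((A + 1) * 4) with hθ
  calc GraphonSignal.didmDist L Q G.toGraphonSignal
      ≤ A * ((∫⁻ x, E₀ x) + ∫⁻ x, e x) := hbound Q _ _ E₀ e hclose
    _ ≤ (A + 1) * (θ + 3 * θ) := by
        gcongr
        exact le_self_add
    _ = (A + 1) * 4 * θ := by ring
    _ = ENNReal.ofReal ε / 2 := ENNReal.mul_div_cancel hA0 hA4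
    _ < ENNReal.ofReal ε := ENNReal.half_lt_self (by simp [hε]) (by simp)
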